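/- Let $\mathbb{Z}_{\max} = \mathbb{Z}\cup\{-\infty\}$ be the tropical integer semiring, with addition $\max$ and multiplication the usual addition of integers, $-\infty$ being absorbing for it; its zero is $-\infty$ and its one is the integer $0$. Let $M_3(\mathbb{Z}_{\max})$ be the monoid of all $3\times 3$ matrices over $\mathbb{Z}_{\max}$ under matrix multiplication. For $\lambda \in \mathbb{Z}_{\max}$ let $A_1(\lambda)$ be the diagonal matrix with diagonal $(\lambda, 0, 0)$ and all off-diagonal entries $-\infty$. For $\sigma \in \mathcal{S}_3$ let $P_\sigma$ be the permutation matrix whose $(i,j)$ entry is $0$ if $j = \sigma(i)$ and $-\infty$ otherwise. Let $E_{12}$ be the matrix whose diagonal entries and $(1,2)$ entry are $0$ and whose other entries are $-\infty$. Put \[ A = A_1(1)\cdot P_{(1,2)}, \qquad B = A_1(-1)\cdot P_{(1,2,3)}, \] where $1$ and $-1$ are the integers and $(1,2,3)$ is the cycle $1\mapsto 2\mapsto 3\mapsto 1$. Then the submonoid of $M_3(\mathbb{Z}_{\max})$ generated by the four matrices $A$, $B$, $E_{12}$ and $A_1(-\infty)$ contains every regular matrix of $M_3(\mathbb{Z}_{\max})$,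 that is, every $X \in M_3(\mathbb{Z}_{\max})$ for which there exists $Y \in M_3(\mathbb{Z}_{\max})$ with $XYX = X$. -/

import Mathlib

/-- The tropical integers `ℤ ∪ {-∞}`; the element `-∞` is `⊥ : WithBot ℤ`. -/
@[ext]
structure ZMax where
  /-- The underlying element of `ℤ ∪ {-∞}`. -/
  val : WithBot ℤ

namespace ZMax

instance : DecidableEq ZMax := fun a b =>
  decidable_of_iff (a.val = b.val) ZMax.ext_iff.symm

/-- The semiring zero is `-∞`. -/
instance : Zero ZMax := ⟨⟨⊥⟩⟩

/-- The semiring one is the integer `0`. -/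
instance : One ZMax := ⟨⟨((0 : ℤ) : WithBot ℤ)⟩⟩

/-- Semiring addition is the maximum. -/
instance : Add ZMax := ⟨fun a b => ⟨max a.val b.val⟩⟩

/-- Semiring multiplication is the addition of `ℤ ∪ {-∞}`, with `-∞` absorbing. -/
instance : Mul ZMax := ⟨fun a b => ⟨a.val + b.val⟩⟩

@[simp] theorem val_zero : (0 : ZMax).val = ⊥ := rfl

@[simp] theorem val_one : (1 : ZMax).val = 0 := rfl

@[simp] theorem val_add (a b : ZMax) : (a + b).val = max a.val b.val := rfl

@[simp] theorem val_mul (a b : ZMax) : (a * b).val = a.val + b.val := rfl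

instance : CommSemiring ZMax where
  add_assoc a b c := ZMax.ext (by simp [max_assoc])
  zero_add a := ZMax.ext (by simp)
  add_zero a := ZMax.ext (by simp)
  add_comm a b := ZMax.ext (by simp [max_comm])
  nsmul := nsmulRec
  mul_assoc a b c := ZMax.ext (by simp [add_assoc])
  one_mul a := ZMax.ext (by simp)
  mul_one a := ZMax.ext (by simp)
  mul_comm a b := ZMax.ext (by simp [add_comm])
  zero_mul a := ZMax.ext (by simp)
  mul_zero a := ZMax.ext (by simp)
  left_distrib a b c := ZMax.ext (by simp [max_add_add_left])
  right_distrib a b c := ZMax.ext (by simp [max_add_add_right])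

/-- The integer `k`, regarded as an element of `ℤ ∪ {-∞}`. It is not the numeral `k` of the
semiring: `ofInt 0` is the semiring one. -/
def ofInt (k : ℤ) : ZMax := ⟨(k : WithBot ℤ)⟩

/-- The element `-∞`, which is the semiring zero. -/
def negInf : ZMax := ⟨⊥⟩

end ZMax

/-- An element `x` of a semigroup is (von Neumann) regular if `x * y * x = x` for some `y`. -/
def IsRegularElement {M : Type*} [Semigroup M] (x : M) : Prop :=
  ∃ y : M, x * y * x = x

/-- `diagAt i c` is the diagonal matrix with `c` as its `(i, i)` entry and `1` elsewhere on the
diagonal. -/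
def diagAt {n S : Type*} [DecidableEq n] [Semiring S] (i : n) (c : S) : Matrix n n S :=
  Matrix.diagonal fun k => if k = i then c else 1

/-- `elemAt i j c`, for `i ≠ j`, is the matrix with every diagonal entry `1`, with `c` as its
`(i, j)` entry, and `0` elsewhere. -/
def elemAt {n S : Type*} [DecidableEq n] [Semiring S] (i j : n) (c : S) : Matrix n n S :=
  Matrix.of fun k l => if k = l then 1 else if k = i ∧ l = j then c else 0

/-- `permMat σ` is the matrix whose `(i, j)` entry is `1` if `j = σ i` and `0` otherwise. -/
def permMat {n S : Type*} [DecidableEq n] [Semiring S] (σ : Equiv.Perm n) : Matrix n n S :=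
  Matrix.of fun i j => if j = σ i then 1 else 0

/-- `A = A₁(1) · P₍₁,₂₎`, where the entry `1` is the integer and indices start at `0`. -/
def genA : Matrix (Fin 3) (Fin 3) ZMax :=
  diagAt 0 (ZMax.ofInt 1) * permMat (Equiv.swap 0 1)

/-- `B = A₁(-1) · P₍₁,₂,₃₎`; the rotation `finRotate 3` is the cycle `0 ↦ 1 ↦ 2 ↦ 0`. -/
def genB : Matrix (Fin 3) (Fin 3) ZMax :=
  diagAt 0 (ZMax.ofInt (-1)) * permMat (finRotate 3)

/-- `E₁₂ = E₁₂(1_S)`, where the semiring one `1_S` is the integer `0`. -/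
def genE12 : Matrix (Fin 3) (Fin 3) ZMax :=
  elemAt 0 1 1

/-- `A₁(-∞)`. -/
def genA1NegInf : Matrix (Fin 3) (Fin 3) ZMax :=
  diagAt 0 ZMax.negInf

/-!
The submonoid `genMonoid` generated by the four matrices contains every diagonal matrix, every
permutation matrix and every elementary matrix, and it is closed under transposition
(`isAbundant_genMonoid`). Indeed `B²A²B = A₁(-1)`; multiplying `A` and `B` by `A₁(∓1)` then gives
the permutation matrices `P₍₁,₂₎` and `P₍₁,₂,₃₎`, and conjugation by permutation and diagonal
matrices gives the rest from `E₁₂` and `A₁(-∞)`.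

Two facts produce further matrices. A matrix `F` with unit diagonal and `F i j * F j k ≤ F i k` is
the product of its elementary matrices in any order (`IsAbundant.mem_of_transitive`). And if one
column of `N` is a combination of the others, then `N` is the product of `N` with that column
erased and a matrix of the first kind (`IsAbundant.mem_of_dependentCol`); likewise for rows.

Let `X * Y * X = X` and put `F = Y * X`, so that `X * F = X` and `F * F = F`.

* If no column of `X` is a combination of the others, then `F` has unit diagonal, and so it belongs
  to the submonoid. A term `Y j i * X i j` attaining the maximum in `F j j = 1` determines a row
  `i = σ j`; independence makes `σ` a permutation, and `X` is `F` up to scaling and permuting rows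
  (`IsAbundant.mem_of_regular_of_independent`).
* If some column is dependent, it may be erased. The rows now lie in a cone of dimension two, where
  among any three vectors ordered by slope the middle one is a combination of the outer ones, so a
  row may be erased as well (`IsAbundant.mem_of_zero_col`). What remains is a `2 × 2` block, and
  every such block is a product of the required kind (`IsAbundant.mem_of_block`). Regularity plays
  no role in this case.
-/

/-! ### The order on the tropical integers -/

namespace ZMax

/-- The order of `ℤ ∪ {-∞}`, for which semiring addition is the maximum. -/
instance : LinearOrder ZMax :=
  LinearOrder.lift' ZMax.val fun _ _ h => ZMax.ext h

theorem le_def {a b : ZMax} : a ≤ b ↔ a.val ≤ b.val := Iff.rfl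

theorem add_eq_max (a b : ZMax) : a + b = max a b := by
  rcases le_total a b with h | h
  · rw [max_eq_right h]; exact ZMax.ext (max_eq_right (le_def.1 h))
  · rw [max_eq_left h]; exact ZMax.ext (max_eq_left (le_def.1 h))

instance : CanonicallyOrderedAdd ZMax where
  exists_add_of_le {a b} h := ⟨b, by rw [add_eq_max, max_eq_right h]⟩
  le_self_add a b := by rw [add_eq_max]; exact le_max_left _ _
  le_add_self a b := by rw [add_eq_max]; exact le_max_right _ _

instance : IsOrderedAddMonoid ZMax where
  add_le_add_left a b h c := by
    rw [add_eq_max, add_eq_max]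
    exact max_le_max_right c h

instance : MulLeftMono ZMax where
  elim a _ _ h := le_def.2 (add_le_add_right (le_def.1 h) a.val)

theorem exists_ofInt {a : ZMax} (ha : a ≠ 0) : ∃ k : ℤ, a = ofInt k := by
  obtain ⟨v⟩ := a
  induction v using WithBot.recBotCoe with
  | bot => exact absurd rfl ha
  | coe k => exact ⟨k, rfl⟩

theorem ofInt_mul (k l : ℤ) : ofInt k * ofInt l = ofInt (k + l) := rfl

theorem ofInt_zero : ofInt 0 = 1 := rfl

theorem exists_mul_eq_one {a : ZMax} (ha : a ≠ 0) : ∃ b, a * b = 1 := by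
  obtain ⟨k, rfl⟩ := exists_ofInt ha
  exact ⟨ofInt (-k), by rw [ofInt_mul, add_neg_cancel, ofInt_zero]⟩

instance : NoZeroDivisors ZMax where
  eq_zero_or_eq_zero_of_mul_eq_zero {a b} h := by
    by_contra! hab
    obtain ⟨c, hc⟩ := exists_mul_eq_one hab.1
    exact hab.2 (by rw [← one_mul b, ← hc, mul_right_comm, h, zero_mul])

theorem add_le_iff {a b c : ZMax} : a + b ≤ c ↔ a ≤ c ∧ b ≤ c := by
  rw [add_eq_max, max_le_iff]

theorem add_eq_left_of_le {a b : ZMax} (h : b ≤ a) : a + b = a := by rw [add_eq_max, max_eq_left h]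

theorem add_eq_right_of_le {a b : ZMax} (h : a ≤ b) : a + b = b := by rw [add_eq_max, max_eq_right h]

theorem exists_le_of_le_sum {ι : Type*} {s : Finset ι} {f : ι → ZMax} {b : ZMax} (hb : b ≠ 0)
    (h : b ≤ ∑ i ∈ s, f i) : ∃ i ∈ s, b ≤ f i := by
  by_contra! hf
  refine absurd h (not_le.2 ?_)
  refine Finset.sum_induction f (· < b) (fun x y hx hy => ?_)
    (lt_of_le_of_ne zero_le hb.symm) hf
  rw [add_eq_max]
  exact max_lt hx hy

end ZMax

/-! ### Matrices built from diagonal, permutation and elementary matrices -/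

open ZMax Matrix

section Abundant

variable {n : Type*} [DecidableEq n]

theorem permMat_one : (permMat 1 : Matrix n n ZMax) = 1 := by
  ext1 i k
  simp [permMat, Matrix.one_apply, eq_comm]

theorem permMat_transpose (σ : Equiv.Perm n) :
    (permMat σ : Matrix n n ZMax)ᵀ = permMat σ⁻¹ := by
  ext1 i k
  simp only [permMat, Matrix.transpose_apply, Matrix.of_apply, Equiv.Perm.eq_inv_iff_eq, eq_comm]

theorem elemAt_transpose (i j : n) (c : ZMax) :
    (elemAt i j c)ᵀ = elemAt j i c := by
  ext1 k l
  simp only [elemAt, Matrix.transpose_apply, Matrix.of_apply, eq_comm (a := k), and_comm]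

variable [Fintype n]

/-- A submonoid of matrices is abundant if it is closed under transposition and contains all
diagonal matrices, singular ones included, all permutation matrices and all elementary matrices. -/
structure IsAbundant (T : Submonoid (Matrix n n ZMax)) : Prop where
  diagonal_mem : ∀ d : n → ZMax, diagonal d ∈ T
  permMat_mem : ∀ σ : Equiv.Perm n, permMat σ ∈ T
  elemAt_mem : ∀ (i j : n) (c : ZMax), i ≠ j → elemAt i j c ∈ T
  transpose_mem : ∀ N ∈ T, Nᵀ ∈ T

theorem permMat_mul_apply (σ : Equiv.Perm n) (N : Matrix n n ZMax) (i k : n) :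
    ((permMat σ : Matrix n n ZMax) * N) i k = N (σ i) k := by
  simp [Matrix.mul_apply, permMat]

theorem permMat_mul_permMat (σ τ : Equiv.Perm n) :
    (permMat σ * permMat τ : Matrix n n ZMax) = permMat (τ * σ) := by
  ext1 i k
  rw [permMat_mul_apply]
  rfl

theorem mul_permMat_apply (σ : Equiv.Perm n) (N : Matrix n n ZMax) (i k : n) :
    (N * (permMat σ : Matrix n n ZMax)) i k = N i (σ⁻¹ k) := by
  have := permMat_mul_apply σ⁻¹ Nᵀ k i
  rwa [← permMat_transpose, ← Matrix.transpose_mul] at this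

theorem elemAt_mul_apply {i j : n} (hij : i ≠ j) (c : ZMax) (N : Matrix n n ZMax) (k l : n) :
    (elemAt i j c * N) k l = if k = i then N i l + c * N j l else N k l := by
  have : elemAt i j c = 1 + Matrix.single i j c := by
    ext1 a b
    by_cases hab : a = b
    · subst hab
      have : ¬ (i = a ∧ j = a) := fun h => hij (h.1.trans h.2.symm)
      simp [elemAt, this]
    · simp [elemAt, Matrix.single_apply, hab, eq_comm]
  rw [this, Matrix.add_mul, Matrix.one_mul, Matrix.add_apply]
  by_cases hk : k = i
  · subst hk; simp
  · simp [hk, Matrix.single_mul_apply_of_ne]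

variable {T : Submonoid (Matrix n n ZMax)} (hT : IsAbundant T)

include hT

theorem IsAbundant.of_transpose {N : Matrix n n ZMax} (h : Nᵀ ∈ T) : N ∈ T := by
  simpa using hT.transpose_mem _ h

theorem IsAbundant.of_submatrix {N : Matrix n n ZMax} (σ τ : Equiv.Perm n)
    (h : N.submatrix σ τ ∈ T) : N ∈ T := by
  have : N = (permMat σ⁻¹ : Matrix n n ZMax) * N.submatrix σ τ * permMat τ := by
    ext1 i k
    simp [mul_permMat_apply, permMat_mul_apply]
  rw [this]
  exact T.mul_mem (T.mul_mem (hT.permMat_mem _) h) (hT.permMat_mem _)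

end Abundant

section Reduction

variable {n : Type*} [Fintype n] [DecidableEq n]

/-! ### Transitive matrices with unit diagonal (Kleene stars) -/

/-- Multiplying the elementary matrices with entries `F i j` over all pairs `i ≠ j`, in any order,
gives `F`: transitivity keeps the product below `F`, and it is at least each of its factors. -/
theorem IsAbundant.mem_of_transitive {T : Submonoid (Matrix n n ZMax)} (hT : IsAbundant T)
    {F : Matrix n n ZMax} (h1 : ∀ i, F i i = 1) (h2 : ∀ i j k, F i j * F j k ≤ F i k) :
    F ∈ T := by
  have key : ∀ l : List (n × n), (∀ p ∈ l, p.1 ≠ p.2) → ∃ P ∈ T,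
      (∀ i j, P i j ≤ F i j) ∧ (∀ i, 1 ≤ P i i) ∧ ∀ p ∈ l, F p.1 p.2 ≤ P p.1 p.2 := by
    intro l
    induction l with
    | nil =>
      refine fun _ => ⟨1, T.one_mem, fun i j => ?_, fun i => ?_, by simp⟩
      · rcases eq_or_ne i j with rfl | hij
        · simp [h1]
        · simp [hij, zero_le]
      · simp
    | cons p l ih =>
      intro hl
      obtain ⟨P, hP, hle, hdiag, hge⟩ := ih fun q hq => hl q (List.mem_cons_of_mem _ hq)
      obtain ⟨a, b⟩ := p
      have hab : a ≠ b := hl (a, b) List.mem_cons_self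
      have hmono : ∀ k m, P k m ≤ (elemAt a b (F a b) * P) k m := by
        intro k m
        rw [elemAt_mul_apply hab]
        split_ifs with hk
        · subst hk; exact le_self_add
        · exact le_rfl
      refine ⟨elemAt a b (F a b) * P, T.mul_mem (hT.elemAt_mem _ _ _ hab) hP, ?_, ?_, ?_⟩
      · intro i j
        rw [elemAt_mul_apply hab]
        split_ifs with hi
        · subst hi
          exact add_le_iff.2 ⟨hle _ _, (mul_le_mul' le_rfl (hle _ _)).trans (h2 _ _ _)⟩
        · exact hle _ _
      · exact fun i => (hdiag i).trans (hmono i i)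
      · intro q hq
        rcases List.mem_cons.1 hq with rfl | hq
        · rw [elemAt_mul_apply hab, if_pos rfl]
          refine le_trans ?_ (le_add_self)
          simpa using mul_le_mul' (le_refl (F a b)) (hdiag b)
        · exact (hge q hq).trans (hmono _ _)
  obtain ⟨P, hP, hle, hdiag, hge⟩ := key (Finset.univ.offDiag : Finset (n × n)).toList (by simp)
  have : F = P := by
    ext1 i j
    refine le_antisymm ?_ (hle i j)
    rcases eq_or_ne i j with rfl | hij
    · exact (h1 i).le.trans (hdiag i)
    · exact hge (i, j) (by simpa using hij)
  rwa [this]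

/-! ### Dependent columns and rows -/

/-- Column `j` of `N` is a linear combination of the other columns; the value `c j` is ignored. Row
`i` of `N` is dependent if `DependentCol Nᵀ i`. -/
def DependentCol (N : Matrix n n ZMax) (j : n) : Prop :=
  ∃ c : n → ZMax, ∀ k, N k j = ∑ l ∈ Finset.univ.erase j, N k l * c l

/-- The identity matrix with the off-diagonal entries of column `j` replaced by those of `c`. -/
def colMat (j : n) (c : n → ZMax) : Matrix n n ZMax :=
  Matrix.of fun k l => if k = l then 1 else if l = j then c k else 0

variable {T : Submonoid (Matrix n n ZMax)} (hT : IsAbundant T)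

include hT

theorem IsAbundant.colMat_mem (j : n) (c : n → ZMax) : colMat j c ∈ T := by
  refine hT.mem_of_transitive (fun i => by simp [colMat]) fun a b d => ?_
  rcases eq_or_ne a b with rfl | hab
  · simp [colMat]
  rcases eq_or_ne b d with rfl | hbd
  · simp [colMat]
  rcases eq_or_ne b j with rfl | hbj
  · simp [colMat, hbd, hbd.symm, zero_le]
  · simp [colMat, hab, hbj, zero_le]

/-- A dependent column may be replaced by zero. -/
theorem IsAbundant.mem_of_dependentCol {N : Matrix n n ZMax} {j : n} (hN : DependentCol N j)
    (h : N * diagonal (fun k => if k = j then 0 else 1) ∈ T) : N ∈ T := by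
  obtain ⟨c, hc⟩ := hN
  have : N = N * diagonal (fun k => if k = j then 0 else 1) * colMat j c := by
    ext1 i k
    rw [Matrix.mul_apply]
    simp only [Matrix.mul_diagonal]
    rw [← Finset.add_sum_erase _ _ (Finset.mem_univ j), if_pos rfl, mul_zero, zero_mul, zero_add]
    rcases eq_or_ne k j with rfl | hkj
    · rw [hc i]
      refine Finset.sum_congr rfl fun l hl => ?_
      simp [colMat, (Finset.mem_erase.1 hl).1]
    · rw [Finset.sum_eq_single k]
      · simp [colMat, hkj]
      · intro l _ hlk
        simp [colMat, hlk, hkj]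
      · intro hk
        simp [hkj] at hk
  rw [this]
  exact T.mul_mem h (hT.colMat_mem j c)

theorem IsAbundant.mem_of_dependentRow {N : Matrix n n ZMax} {i : n} (hN : DependentCol Nᵀ i)
    (h : diagonal (fun k => if k = i then 0 else 1) * N ∈ T) : N ∈ T := by
  refine hT.of_transpose (hT.mem_of_dependentCol hN ?_)
  refine hT.of_transpose ?_
  simpa [Matrix.transpose_mul] using h

/-- A matrix with a single nonzero column is a column operation applied to a matrix with a single
nonzero entry. -/
theorem IsAbundant.mem_of_single_col {N : Matrix n n ZMax} (j : n)
    (hN : ∀ i k, k ≠ j → N i k = 0) : N ∈ T := by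
  by_cases h0 : ∃ i, N i j ≠ 0
  · obtain ⟨i, hi⟩ := h0
    obtain ⟨y, hy⟩ := exists_mul_eq_one hi
    have : N = colMat i (fun k => N k j * y) * diagonal (fun k => if k = i then N i j else 0) *
        permMat (Equiv.swap i j) := by
      ext1 a b
      rw [mul_permMat_apply, Equiv.swap_inv, Matrix.mul_diagonal]
      rcases eq_or_ne b j with rfl | hb
      · rw [Equiv.swap_apply_right, if_pos rfl]
        rcases eq_or_ne a i with rfl | ha
        · simp [colMat]
        · simp [colMat, ha, mul_assoc, mul_comm y, hy]
      · rw [hN a b hb, if_neg, mul_zero]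
        rwa [Equiv.swap_apply_eq_iff, Equiv.swap_apply_left]
    rw [this]
    exact T.mul_mem (T.mul_mem (hT.colMat_mem _ _) (hT.diagonal_mem _)) (hT.permMat_mem _)
  · push Not at h0
    have : N = diagonal 0 := by
      ext1 a b
      rcases eq_or_ne b j with rfl | hb
      · simp [h0]
      · simp [hN a b hb]
    rw [this]
    exact hT.diagonal_mem _

theorem IsAbundant.mem_of_single_row {N : Matrix n n ZMax} (i : n)
    (hN : ∀ k j, k ≠ i → N k j = 0) : N ∈ T :=
  hT.of_transpose (hT.mem_of_single_col i fun a b hb => hN b a hb)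

/-! ### Regular matrices with independent columns -/

omit hT in
/-- If `X * F = X`, a diagonal entry of `F` other than `1` contributes nothing to its column of `X`,
which is then the combination of the other columns given by `F`. -/
theorem dependentCol_of_ne_one {X F : Matrix n n ZMax} (hX : X = X * F) {j : n}
    (hj : F j j ≠ 1) : DependentCol X j := by
  have hk : ∀ k, X k j = X k j * F j j + ∑ l ∈ Finset.univ.erase j, X k l * F l j := by
    intro k
    conv_lhs => rw [hX]
    rw [Matrix.mul_apply, ← Finset.add_sum_erase _ _ (Finset.mem_univ j)]
  refine ⟨fun l => F l j, fun k => ?_⟩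
  refine le_antisymm ?_ ((le_add_self).trans (hk k).ge)
  by_cases h0 : X k j = 0
  · rw [h0]; exact zero_le
  obtain ⟨y, hy⟩ := exists_mul_eq_one h0
  have hk' := hk k
  rw [add_eq_max] at hk'
  rcases max_choice (X k j * F j j) (∑ l ∈ Finset.univ.erase j, X k l * F l j) with h | h
  · rw [h] at hk'
    refine absurd ?_ hj
    rw [← one_mul (F j j), ← hy, mul_right_comm, ← hk', hy]
  · rw [h] at hk'
    exact hk'.le

/-- A regular matrix with independent columns is, up to scaling and permuting its rows, the
idempotent `F = Y * X` of an inner inverse `Y`, and `F` is transitive with unit diagonal. -/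
theorem IsAbundant.mem_of_regular_of_independent {X : Matrix n n ZMax} (hX : IsRegularElement X)
    (hind : ∀ j, ¬ DependentCol X j) : X ∈ T := by
  obtain ⟨Y, hY⟩ := hX
  set F := Y * X with hF
  have hXF : X = X * F := by rw [hF, ← Matrix.mul_assoc, hY]
  have hFF : F = F * F := by
    conv_lhs => rw [hF, ← hY]
    simp only [hF, Matrix.mul_assoc]
  have hF1 : ∀ j, F j j = 1 := fun j => by
    by_contra h
    exact hind j (dependentCol_of_ne_one hXF h)
  have hle : ∀ {P Q : Matrix n n ZMax} (i j k : n), P i j * Q j k ≤ (P * Q) i k := by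
    intro P Q i j k
    rw [Matrix.mul_apply]
    exact Finset.single_le_sum_of_canonicallyOrdered (f := fun j => P i j * Q j k) (Finset.mem_univ j)
  have hFtrans : ∀ i j k, F i j * F j k ≤ F i k := fun i j k => (hle i j k).trans_eq (by rw [← hFF])
  -- In the sum `F j j = ∑ i, Y j i * X i j = 1` some term attains the maximum.
  have hex : ∀ j, ∃ i, Y j i * X i j = 1 := fun j => by
    have h1 : F j j = ∑ i, Y j i * X i j := by rw [hF, Matrix.mul_apply]
    obtain ⟨i, -, hi⟩ := exists_le_of_le_sum (by decide) ((hF1 j).ge.trans_eq h1)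
    exact ⟨i, le_antisymm ((hle j i j).trans_eq (hF1 j)) hi⟩
  choose σ hσ using hex
  have hσinj : Function.Injective σ := by
    intro j j' hjj
    by_contra hne
    -- Two columns sharing a row for the maximum would be proportional.
    have h1 : 1 ≤ F j j' * F j' j := by
      have := mul_le_mul' (hle (P := Y) (Q := X) j (σ j) j') (hle (P := Y) (Q := X) j' (σ j) j)
      refine le_trans (le_of_eq ?_) this
      have h2 := hσ j'
      rw [← hjj] at h2
      calc 1 = (Y j (σ j) * X (σ j) j) * (Y j' (σ j) * X (σ j) j') := by rw [hσ, h2, one_mul]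
        _ = _ := by ring
    refine hind j ⟨fun l => if l = j' then F j' j else 0, fun k => ?_⟩
    rw [Finset.sum_eq_single j' (fun l _ hl => by simp [hl]) (by simp [Ne.symm hne])]
    beta_reduce
    rw [if_pos rfl]
    refine le_antisymm ?_ ((hle k j' j).trans_eq (by rw [← hXF]))
    calc X k j = X k j * 1 := (mul_one _).symm
      _ ≤ X k j * (F j j' * F j' j) := mul_le_mul' le_rfl h1
      _ = X k j * F j j' * F j' j := (mul_assoc _ _ _).symm
      _ ≤ X k j' * F j' j := mul_le_mul' ((hle k j j').trans_eq (by rw [← hXF])) le_rfl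
  let τ : Equiv.Perm n := Equiv.ofBijective σ (Finite.injective_iff_bijective.1 hσinj)
  refine hT.of_submatrix τ (Equiv.refl n) ?_
  have : X.submatrix τ (Equiv.refl n) = diagonal (fun j => X (σ j) j) * F := by
    ext1 j l
    rw [Matrix.diagonal_mul]
    change X (σ j) l = _
    refine le_antisymm ?_ ((hle (σ j) j l).trans_eq (by rw [← hXF]))
    calc X (σ j) l = X (σ j) j * (Y j (σ j) * X (σ j) l) := by
          rw [← mul_assoc, mul_comm (X (σ j) j), hσ, one_mul]
      _ ≤ _ := mul_le_mul' le_rfl (hle j (σ j) l)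
  rw [this]
  exact T.mul_mem (hT.diagonal_mem _) (hT.mem_of_transitive hF1 hFtrans)

end Reduction

/-! ### Three by three matrices with a zero column -/

section Three

variable {T : Submonoid (Matrix (Fin 3) (Fin 3) ZMax)} (hT : IsAbundant T)

include hT

/-- If the diagonal term dominates in the `2 × 2` block and is nonzero, the block is a transitive
matrix with unit diagonal up to scaling of its rows; if it is zero, the block has a zero row or a
zero column. -/
theorem IsAbundant.mem_of_block_of_le {N : Matrix (Fin 3) (Fin 3) ZMax}
    (hcol : ∀ i, N i 2 = 0) (hrow : ∀ j, N 2 j = 0)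
    (hle : N 0 1 * N 1 0 ≤ N 0 0 * N 1 1) : N ∈ T := by
  by_cases h0 : N 0 0 = 0 ∨ N 1 1 = 0
  · have h1 : N 0 1 = 0 ∨ N 1 0 = 0 := by
      refine mul_eq_zero.1 (le_zero_iff.1 (hle.trans_eq ?_))
      rcases h0 with h | h <;> simp [h]
    rcases h0 with h | h <;> rcases h1 with h' | h'
    · exact hT.mem_of_single_row 1 (by
        intro k j hk; fin_cases k <;> fin_cases j <;> simp_all)
    · exact hT.mem_of_single_col 1 (by
        intro k j hk; fin_cases k <;> fin_cases j <;> simp_all)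
    · exact hT.mem_of_single_col 0 (by
        intro k j hk; fin_cases k <;> fin_cases j <;> simp_all)
    · exact hT.mem_of_single_row 0 (by
        intro k j hk; fin_cases k <;> fin_cases j <;> simp_all)
  push Not at h0
  obtain ⟨x, hx⟩ := exists_mul_eq_one h0.1
  obtain ⟨y, hy⟩ := exists_mul_eq_one h0.2
  have hcyc : (x * N 0 1) * (y * N 1 0) ≤ 1 := by
    calc (x * N 0 1) * (y * N 1 0) = (x * y) * (N 0 1 * N 1 0) := by ring
      _ ≤ (x * y) * (N 0 0 * N 1 1) := mul_le_mul' le_rfl hle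
      _ = (N 0 0 * x) * (N 1 1 * y) := by ring
      _ = 1 := by rw [hx, hy, one_mul]
  have hF : (!![1, x * N 0 1, 0; y * N 1 0, 1, 0; 0, 0, 1] : Matrix (Fin 3) (Fin 3) ZMax) ∈ T := by
    refine hT.mem_of_transitive (fun i => by fin_cases i <;> rfl) fun i j k => ?_
    have hcyc' := hcyc
    rw [mul_comm] at hcyc'
    fin_cases i <;> fin_cases j <;> fin_cases k <;> simp [zero_le, hcyc, hcyc']
  have : N = diagonal ![N 0 0, N 1 1, 0] *
      !![1, x * N 0 1, 0; y * N 1 0, 1, 0; 0, 0, 1] := by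
    ext1 i j
    rw [Matrix.diagonal_mul]
    fin_cases i <;> fin_cases j <;> simp [← mul_assoc, hx, hy, hcol, hrow]
  rw [this]
  exact T.mul_mem (hT.diagonal_mem _) hF

theorem IsAbundant.mem_of_block {N : Matrix (Fin 3) (Fin 3) ZMax}
    (hcol : ∀ i, N i 2 = 0) (hrow : ∀ j, N 2 j = 0) : N ∈ T := by
  rcases le_total (N 0 1 * N 1 0) (N 0 0 * N 1 1) with h | h
  · exact hT.mem_of_block_of_le hcol hrow h
  · refine hT.of_submatrix (Equiv.swap 0 1) (Equiv.refl _)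
      (hT.mem_of_block_of_le (fun i => hcol _) (fun j => hrow j) ?_)
    change N 1 1 * N 0 0 ≤ N 1 0 * N 0 1
    rwa [mul_comm, mul_comm (N 1 0)]

theorem IsAbundant.mem_of_zero_col_of_zero_row {N : Matrix (Fin 3) (Fin 3) ZMax} (i j : Fin 3)
    (hcol : ∀ k, N k j = 0) (hrow : ∀ k, N i k = 0) : N ∈ T := by
  refine hT.of_submatrix (Equiv.swap i 2) (Equiv.swap j 2) (hT.mem_of_block ?_ ?_)
  · intro k; simp [hcol]
  · intro k; simp [hrow]

omit hT in
/-- A total relation on three points has a Hamiltonian path; no transitivity is needed. -/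
theorem exists_chain (r : Fin 3 → Fin 3 → Prop) (hr : ∀ i j, r i j ∨ r j i) :
    ∃ a b c : Fin 3, a ≠ b ∧ b ≠ c ∧ a ≠ c ∧ r a b ∧ r b c := by
  rcases hr 0 1 with h | h <;> rcases hr 1 2 with h' | h' <;> rcases hr 0 2 with h'' | h''
  · exact ⟨0, 1, 2, by decide, by decide, by decide, h, h'⟩
  · exact ⟨0, 1, 2, by decide, by decide, by decide, h, h'⟩
  · exact ⟨0, 2, 1, by decide, by decide, by decide, h'', h'⟩
  · exact ⟨2, 0, 1, by decide, by decide, by decide, h'', h⟩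
  · exact ⟨1, 0, 2, by decide, by decide, by decide, h, h''⟩
  · exact ⟨1, 2, 0, by decide, by decide, by decide, h', h''⟩
  · exact ⟨2, 1, 0, by decide, by decide, by decide, h', h⟩
  · exact ⟨2, 1, 0, by decide, by decide, by decide, h', h⟩

omit hT in
/-- Of three vectors ordered by slope, the middle one is a combination of the outer two, unless an
outer one vanishes. -/
theorem exists_dependentRow_of_chain {N : Matrix (Fin 3) (Fin 3) ZMax} (hcol : ∀ i, N i 2 = 0)
    (a b c : Fin 3) (hab : a ≠ b) (hbc : b ≠ c) (hac : a ≠ c) (h1 : N a 0 * N b 1 ≤ N b 0 * N a 1)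
    (h2 : N b 0 * N c 1 ≤ N c 0 * N b 1) : ∃ i, DependentCol Nᵀ i := by
  have hzero : ∀ i, N i 0 = 0 → N i 1 = 0 → DependentCol Nᵀ i := fun i h h' =>
    ⟨0, fun k => by fin_cases k <;> simp [h, h', hcol]⟩
  -- Coefficients matching row `b` in one coordinate each without exceeding it in the other.
  have hα : (N a 0 = 0 ∧ N a 1 = 0) ∨ ∃ α, α * N a 1 = N b 1 ∧ α * N a 0 ≤ N b 0 := by
    by_cases h : N a 1 = 0
    · rw [h, mul_zero, le_zero_iff] at h1
      rcases mul_eq_zero.1 h1 with h' | h'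
      · exact Or.inl ⟨h', h⟩
      · exact Or.inr ⟨0, by simp [h'], by simp [zero_le]⟩
    · obtain ⟨y, hy⟩ := exists_mul_eq_one h
      refine Or.inr ⟨N b 1 * y, by rw [mul_assoc, mul_comm y, hy, mul_one], ?_⟩
      calc N b 1 * y * N a 0 = N a 0 * N b 1 * y := by ring
        _ ≤ N b 0 * N a 1 * y := mul_le_mul' h1 le_rfl
        _ = N b 0 := by rw [mul_assoc, hy, mul_one]
  have hβ : (N c 0 = 0 ∧ N c 1 = 0) ∨ ∃ β, β * N c 0 = N b 0 ∧ β * N c 1 ≤ N b 1 := by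
    by_cases h : N c 0 = 0
    · rw [h, zero_mul, le_zero_iff] at h2
      rcases mul_eq_zero.1 h2 with h' | h'
      · exact Or.inr ⟨0, by simp [h'], by simp [zero_le]⟩
      · exact Or.inl ⟨h, h'⟩
    · obtain ⟨y, hy⟩ := exists_mul_eq_one h
      refine Or.inr ⟨N b 0 * y, by rw [mul_assoc, mul_comm y, hy, mul_one], ?_⟩
      calc N b 0 * y * N c 1 = N b 0 * N c 1 * y := by ring
        _ ≤ N c 0 * N b 1 * y := mul_le_mul' h2 le_rfl
        _ = N b 1 * (N c 0 * y) := by ring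
        _ = N b 1 := by rw [hy, mul_one]
  rcases hα with ⟨h, h'⟩ | ⟨α, hα1, hα0⟩
  · exact ⟨a, hzero a h h'⟩
  rcases hβ with ⟨h, h'⟩ | ⟨β, hβ0, hβ1⟩
  · exact ⟨c, hzero c h h'⟩
  refine ⟨b, fun l => if l = a then α else β, fun k => ?_⟩
  have huniv : (Finset.univ.erase b : Finset (Fin 3)) = {a, c} := by
    clear * - hab hbc hac
    revert a b c; decide
  rw [huniv, Finset.sum_pair hac]
  simp only [Matrix.transpose_apply, if_pos, if_neg hac.symm, mul_comm _ α, mul_comm _ β]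
  fin_cases k
  · exact hβ0.symm.trans (add_eq_right_of_le (hα0.trans_eq hβ0.symm)).symm
  · exact hα1.symm.trans (add_eq_left_of_le (hβ1.trans_eq hα1.symm)).symm
  · simp [hcol]

/-- The rows of a matrix with a zero column span a cone of dimension at most two, which has at most
two extremal rays; so one of the three rows is dependent and may be removed as well. -/
theorem IsAbundant.mem_of_zero_col {N : Matrix (Fin 3) (Fin 3) ZMax} (j : Fin 3)
    (hcol : ∀ k, N k j = 0) : N ∈ T := by
  refine hT.of_submatrix (Equiv.refl _) (Equiv.swap j 2) ?_
  set N' := N.submatrix (Equiv.refl _) (Equiv.swap j 2) with hN'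
  have hcol' : ∀ k, N' k 2 = 0 := fun k => by simp [hN', hcol]
  obtain ⟨a, b, c, hab, hbc, hac, h1, h2⟩ :=
    exists_chain (fun a b => N' a 0 * N' b 1 ≤ N' b 0 * N' a 1) fun a b => le_total _ _
  obtain ⟨i, hi⟩ := exists_dependentRow_of_chain hcol' a b c hab hbc hac h1 h2
  refine hT.mem_of_dependentRow hi (hT.mem_of_zero_col_of_zero_row i 2 ?_ ?_)
  · intro k; simp [Matrix.diagonal_mul, hcol']
  · intro k; simp [Matrix.diagonal_mul]

theorem IsAbundant.mem_of_regular {X : Matrix (Fin 3) (Fin 3) ZMax} (hX : IsRegularElement X) :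
    X ∈ T := by
  by_cases h : ∃ j, DependentCol X j
  · obtain ⟨j, hj⟩ := h
    exact hT.mem_of_dependentCol hj (hT.mem_of_zero_col j fun k => by simp [Matrix.mul_diagonal])
  · exact hT.mem_of_regular_of_independent hX (not_exists.1 h)

end Three

/-! ### The submonoid generated by the four matrices -/

/-- The submonoid generated by the four matrices. -/
def genMonoid : Submonoid (Matrix (Fin 3) (Fin 3) ZMax) :=
  Submonoid.closure {genA, genB, genE12, genA1NegInf}

theorem diagAt_mul_diagAt {n : Type*} [Fintype n] [DecidableEq n] (i : n) (c d : ZMax) :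
    diagAt i c * diagAt i d = diagAt i (c * d) := by
  rw [diagAt, diagAt, diagAt, Matrix.diagonal_mul_diagonal]
  congr 1
  ext1 k
  split_ifs <;> simp

theorem diagAt_one {n : Type*} [DecidableEq n] (i : n) :
    (diagAt i 1 : Matrix n n ZMax) = 1 := by
  simp [diagAt]

theorem permMat_conj {n : Type*} [Fintype n] [DecidableEq n] (σ : Equiv.Perm n)
    (N : Matrix n n ZMax) :
    permMat σ * N * permMat σ⁻¹ = N.submatrix σ σ := by
  ext1 i j
  simp [mul_permMat_apply, permMat_mul_apply]

theorem genA_mem : genA ∈ genMonoid := Submonoid.subset_closure (by simp)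

theorem genB_mem : genB ∈ genMonoid := Submonoid.subset_closure (by simp)

theorem genE12_mem : genE12 ∈ genMonoid := Submonoid.subset_closure (by simp)

theorem genA1NegInf_mem : genA1NegInf ∈ genMonoid := Submonoid.subset_closure (by simp)

/-- The word in `A` and `B` from which the other invertible matrices are derived. -/
theorem diagAt_neg_one_eq :
    diagAt 0 (ofInt (-1)) = genB * genB * (genA * genA) * genB := by
  decide

theorem diagAt_neg_one_mem : diagAt 0 (ofInt (-1)) ∈ genMonoid := by
  rw [diagAt_neg_one_eq]
  exact mul_mem (mul_mem (mul_mem genB_mem genB_mem) (mul_mem genA_mem genA_mem)) genB_mem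

theorem permMat_swap_mem : permMat (Equiv.swap 0 1) ∈ genMonoid := by
  have : (permMat (Equiv.swap 0 1) : Matrix (Fin 3) (Fin 3) ZMax) =
      diagAt 0 (ofInt (-1)) * genA := by
    rw [genA, ← Matrix.mul_assoc, diagAt_mul_diagAt, ofInt_mul, neg_add_cancel, ofInt_zero,
      diagAt_one, Matrix.one_mul]
  rw [this]
  exact mul_mem diagAt_neg_one_mem genA_mem

theorem diagAt_one_mem : diagAt 0 (ofInt 1) ∈ genMonoid := by
  have : diagAt 0 (ofInt 1) = genA * permMat (Equiv.swap 0 1) := by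
    rw [genA, Matrix.mul_assoc, permMat_mul_permMat, Equiv.swap_mul_self, permMat_one,
      Matrix.mul_one]
  rw [this]
  exact mul_mem genA_mem permMat_swap_mem

theorem permMat_finRotate_mem : permMat (finRotate 3) ∈ genMonoid := by
  have : (permMat (finRotate 3) : Matrix (Fin 3) (Fin 3) ZMax) = diagAt 0 (ofInt 1) * genB := by
    rw [genB, ← Matrix.mul_assoc, diagAt_mul_diagAt, ofInt_mul, add_neg_cancel, ofInt_zero,
      diagAt_one, Matrix.one_mul]
  rw [this]
  exact mul_mem diagAt_one_mem genB_mem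

theorem permMat_mem (σ : Equiv.Perm (Fin 3)) : permMat σ ∈ genMonoid := by
  have hword : ∀ σ : Equiv.Perm (Fin 3), ∃ a : Fin 3, ∃ b : Fin 2,
      σ = finRotate 3 ^ (a : ℕ) * Equiv.swap 0 1 ^ (b : ℕ) := by decide
  have hpow : ∀ (τ : Equiv.Perm (Fin 3)), permMat τ ∈ genMonoid → ∀ k : ℕ,
      permMat (τ ^ k) ∈ genMonoid := by
    intro τ hτ k
    induction k with
    | zero => rw [pow_zero, permMat_one]; exact one_mem _
    | succ k ih => rw [pow_succ, ← permMat_mul_permMat]; exact mul_mem hτ ih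
  obtain ⟨a, b, rfl⟩ := hword σ
  rw [← permMat_mul_permMat]
  exact mul_mem (hpow _ permMat_swap_mem _) (hpow _ permMat_finRotate_mem _)

theorem submatrix_mem {N : Matrix (Fin 3) (Fin 3) ZMax} (hN : N ∈ genMonoid)
    (σ : Equiv.Perm (Fin 3)) : N.submatrix σ σ ∈ genMonoid := by
  rw [← permMat_conj]
  exact mul_mem (mul_mem (permMat_mem _) hN) (permMat_mem _)

theorem diagAt_mem (i : Fin 3) (c : ZMax) : diagAt i c ∈ genMonoid := by
  have h0 : diagAt 0 c ∈ genMonoid := by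
    by_cases hc : c = 0
    · subst hc; exact genA1NegInf_mem
    obtain ⟨k, rfl⟩ := exists_ofInt hc
    induction k with
    | zero => rw [ofInt_zero, diagAt_one]; exact one_mem _
    | succ k ih =>
      rw [← ofInt_mul, ← diagAt_mul_diagAt]
      exact mul_mem (ih (by simp [ofInt, ZMax.ext_iff])) diagAt_one_mem
    | pred k ih =>
      rw [sub_eq_add_neg, ← ofInt_mul, ← diagAt_mul_diagAt]
      exact mul_mem (ih (by simp [ofInt, ZMax.ext_iff])) diagAt_neg_one_mem
  have : diagAt i c = (diagAt 0 c).submatrix (Equiv.swap 0 i) (Equiv.swap 0 i) := by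
    ext1 a b
    simp [diagAt, Matrix.diagonal_apply, Equiv.swap_apply_eq_iff]
  rw [this]
  exact submatrix_mem h0 _

theorem diagonal_mem_genMonoid (d : Fin 3 → ZMax) : diagonal d ∈ genMonoid := by
  have : diagonal d = diagAt 0 (d 0) * diagAt 1 (d 1) * diagAt 2 (d 2) := by
    simp only [diagAt, Matrix.diagonal_mul_diagonal]
    congr 1
    ext1 k
    fin_cases k <;> simp
  rw [this]
  exact mul_mem (mul_mem (diagAt_mem _ _) (diagAt_mem _ _)) (diagAt_mem _ _)

theorem elemAt_mem_genMonoid (i j : Fin 3) (c : ZMax) (hij : i ≠ j) :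
    elemAt i j c ∈ genMonoid := by
  by_cases hc : c = 0
  · have : elemAt i j c = 1 := by
      ext1 a b
      simp [elemAt, hc, Matrix.one_apply]
    rw [this]
    exact one_mem _
  obtain ⟨y, hy⟩ := exists_mul_eq_one hc
  obtain ⟨σ, rfl, rfl⟩ : ∃ σ : Equiv.Perm (Fin 3), σ 0 = i ∧ σ 1 = j := by
    revert i j; decide
  have h1 : elemAt (σ 0) (σ 1) 1 ∈ genMonoid := by
    have : elemAt (σ 0) (σ 1) 1 = genE12.submatrix ⇑σ⁻¹ ⇑σ⁻¹ := by
      ext1 a b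
      simp [genE12, elemAt, Equiv.symm_apply_eq]
    rw [this]
    exact submatrix_mem genE12_mem _
  have : elemAt (σ 0) (σ 1) c = diagAt (σ 0) c * elemAt (σ 0) (σ 1) 1 * diagAt (σ 0) y := by
    ext1 a b
    simp only [diagAt, Matrix.mul_diagonal, Matrix.diagonal_mul, elemAt, Matrix.of_apply]
    by_cases ha : a = σ 0 <;> by_cases hb : b = σ 0 <;> by_cases hab : a = b <;> simp_all
  rw [this]
  exact mul_mem (mul_mem (diagAt_mem _ _) h1) (diagAt_mem _ _)

theorem isAbundant_genMonoid : IsAbundant genMonoid where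
  diagonal_mem := diagonal_mem_genMonoid
  permMat_mem := permMat_mem
  elemAt_mem := elemAt_mem_genMonoid
  transpose_mem N hN := by
    induction hN using Submonoid.closure_induction with
    | mem x hx =>
      simp only [Set.mem_insert_iff, Set.mem_singleton_iff] at hx
      rcases hx with rfl | rfl | rfl | rfl
      · rw [genA, Matrix.transpose_mul, permMat_transpose, diagAt, Matrix.diagonal_transpose]
        exact mul_mem (permMat_mem _) (diagonal_mem_genMonoid _)
      · rw [genB, Matrix.transpose_mul, permMat_transpose, diagAt, Matrix.diagonal_transpose]
        exact mul_mem (permMat_mem _) (diagonal_mem_genMonoid _)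
      · rw [genE12, elemAt_transpose]
        exact elemAt_mem_genMonoid _ _ _ (by decide)
      · rw [genA1NegInf, diagAt, Matrix.diagonal_transpose]
        exact diagonal_mem_genMonoid _
    | one => rw [Matrix.transpose_one]; exact one_mem _
    | mul x y _ _ hx hy => rw [Matrix.transpose_mul]; exact mul_mem hy hx

theorem mainTheorem8 (M : Matrix (Fin 3) (Fin 3) ZMax) (hM : IsRegularElement M) :
    M ∈ Submonoid.closure
      ({genA, genB, genE12, genA1NegInf} : Set (Matrix (Fin 3) (Fin 3) ZMax)) :=
  isAbundant_genMonoid.mem_of_regular hM
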